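/- An evidenced frame $\mathcal{EF}=(\Phi,E,\cdot\xrightarrow{\cdot}\cdot)$ consists of a set $\Phi$ of propositions, a set $E$ of evidences and a relation $\phi\xrightarrow{e}\psi$ on $\Phi\times E\times\Phi$, equipped with: $e_{\mathrm{id}}\in E$ with $\phi\xrightarrow{e_{\mathrm{id}}}\phi$; an operation $;$ on $E$ such that $\phi_1\xrightarrow{e_1}\phi_2$ and $\phi_2\xrightarrow{e_2}\phi_3$ imply $\phi_1\xrightarrow{e_1;e_2}\phi_3$; $\top\in\Phi$ and $e_\top\in E$ with $\phi\xrightarrow{e_\top}\top$; $\wedge:\Phi^2\to\Phi$, $\langle\cdot,\cdot\rangle:E^2\to E$ and $e_{\mathrm{fst}},e_{\mathrm{snd}}\in E$ such that $\phi\xrightarrow{e_1}\psi_1$ and $\phi\xrightarrow{e_2}\psi_2$ imply $\phi\xrightarrow{\langle e_1,e_2\rangle}\psi_1\wedge\psi_2$, and $\phi_1\wedge\phi_2\xrightarrow{e_{\mathrm{fst}}}\phi_1$, $\phi_1\wedge\phi_2\xrightarrow{e_{\mathrm{snd}}}\phi_2$; and $\supset:\Phi\times\mathcal P(\Phi)\to\Phi$,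 $\lambda:E\to E$, $e_{\mathrm{eval}}\in E$ such that if $\phi_1\wedge\phi_2\xrightarrow{e}\psi$ for all $\psi\in\Psi$ then $\phi_1\xrightarrow{\lambda e}(\phi_2\supset\Psi)$, and $(\phi\supset\Psi)\wedge\phi\xrightarrow{e_{\mathrm{eval}}}\psi$ for all $\psi\in\Psi$. A proposition $\phi$ is evidenceable if $\top\xrightarrow{e}\phi$ for some $e\in E$. Write $\phi\supset\psi:=\phi\supset\{\psi\}$, $\phi\leftrightarrow\psi:=(\phi\supset\psi)\wedge(\psi\supset\phi)$, $\prod\Psi:=\top\supset\Psi$, $\coprod\Psi:=\prod\{\prod\{\psi\supset\phi\mid\psi\in\Psi\}\supset\phi\mid\phi\in\Phi\}$, and $\prod_{x\in X}\phi(x):=\prod\{\phi(x)\mid x\in X\}$, $\coprod_{x\in X}\phi(x):=\coprod\{\phi(x)\mid x\in X\}$. The category $\mathrm{EFT}(\mathcal{EF})$ is defined as follows. An object is a pair $(X,\sim)$ of a set $X$ and a function $\sim\,:X\times X\to\Phi$ such that $\prod_{x,y}(x\sim y\supset y\sim x)$ and $\prod_{x,y,z}(x\sim y\wedge y\sim z\supset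 x\sim z)$ are evidenceable (here $\prod_{x,y}$ abbreviates the iterated $\prod_x\prod_y$, and so on). Put $\mathsf{ex}(x):=x\sim x$. A functional predicate $F:(X,\sim)\to(Y,\sim)$ is a function $F:X\times Y\to\Phi$ such that $$\prod_{x,x',y,y'}(x\sim x'\wedge y\sim y'\wedge F(x,y)\supset F(x',y')),$$ $$\prod_{x,y,y'}(\mathsf{ex}(x)\wedge\mathsf{ex}(y)\wedge\mathsf{ex}(y')\wedge F(x,y)\wedge F(x,y')\supset y\sim y'),$$ $$\prod_{x}\Big(\mathsf{ex}(x)\supset\coprod_{y}(\mathsf{ex}(y)\wedge F(x,y))\Big)$$ are evidenceable. Morphisms $(X,\sim)\to(Y,\sim)$ are classes $[F]$ of functional predicates, where $F,G$ are equivalent if $\prod_{x,y}(\mathsf{ex}(x)\wedge\mathsf{ex}(y)\supset(F(x,y)\leftrightarrow G(x,y)))$ is evidenceable. Composition is $[G]\circ[F]=[G\circ F]$ with $(G\circ F)(x,z):=\coprod_y(\mathsf{ex}(y)\wedge F(x,y)\wedge G(y,z))$. A function $f:X\to Y$ for which $\prod_{x,x'}(x\sim x'\supset f(x)\sim f(x'))$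 is evidenceable represents the morphism given by the functional predicate $(x,y)\mapsto f(x)\sim y$; identities are represented by identity functions. **Proposition.** For every evidenced frame $\mathcal{EF}$, the category $\mathrm{EFT}(\mathcal{EF})$ is an elementary topos, that is, it has finite limits, is cartesian closed and has a subobject classifier. Moreover: 1. $(\{*\},\,(*,*)\mapsto\top)$ is a terminal object. 2. $(X\times Y,\sim)$ with $(x,y)\sim(x',y'):=x\sim x'\wedge y\sim y'$, together with the morphisms represented by the two projection functions, is a product of $(X,\sim)$ and $(Y,\sim)$. For functional predicates $F:(W,\sim)\to(X,\sim)$ and $G:(W,\sim)\to(Y,\sim)$, the predicate $(w,(x,y))\mapsto F(w,x)\wedge G(w,y)$ is functional and represents the morphism with components $[F]$ and $[G]$. 3. For functional predicates $F,G:(X,\sim)\to(Y,\sim)$, the object $(X,\approx)$ with $x\approx x':=x\sim x'\wedge\coprod_{y\in Y}(\mathsf{ex}(y)\wedge F(x,y)\wedge G(x,y))$, together with the morphism $(X,\approx)\to(X,\sim)$ represented by $\mathrm{id}_X$, is an equalizer of $[F]$ and $[G]$. 4. $(\Phi,\leftrightarrow)$ with the morphism $\mathsf{true}$ from the terminal object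 represented by $*\mapsto\top$ is a subobject classifier: for every monomorphism $m:(S,\sim)\to(X,\sim)$ there is a unique $\chi_m:(X,\sim)\to(\Phi,\leftrightarrow)$ making $m$ the pullback of $\mathsf{true}$ along $\chi_m$. -/

import Mathlib

open CategoryTheory CategoryTheory.Limits

universe u v

set_option linter.checkUnivs false
set_option linter.unusedVariables false

/-- An evidenced frame: propositions `Φ`, evidences `E`, the evidence relation
`Ev φ e ψ` (to be read "`e` is evidence that `φ` entails `ψ`"), together with the logical and
program constructs for reflexivity, transitivity, top, conjunction and universal implication. -/
structure EvidencedFrame where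
  Φ : Type u
  E : Type v
  Ev : Φ → E → Φ → Prop
  eid : E
  ev_id : ∀ φ, Ev φ eid φ
  seq : E → E → E
  ev_seq : ∀ {φ₁ φ₂ φ₃ e₁ e₂}, Ev φ₁ e₁ φ₂ → Ev φ₂ e₂ φ₃ → Ev φ₁ (seq e₁ e₂) φ₃
  top : Φ
  etop : E
  ev_top : ∀ φ, Ev φ etop top
  conj : Φ → Φ → Φ
  pair : E → E → E
  efst : E
  esnd : E
  ev_pair : ∀ {φ ψ₁ ψ₂ e₁ e₂}, Ev φ e₁ ψ₁ → Ev φ e₂ ψ₂ → Ev φ (pair e₁ e₂) (conj ψ₁ ψ₂)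
  ev_fst : ∀ φ₁ φ₂, Ev (conj φ₁ φ₂) efst φ₁
  ev_snd : ∀ φ₁ φ₂, Ev (conj φ₁ φ₂) esnd φ₂
  uimp : Φ → Set Φ → Φ
  lam : E → E
  eeval : E
  ev_lam : ∀ {φ₁ φ₂ : Φ} {Ψ : Set Φ} {e : E},
    (∀ ψ ∈ Ψ, Ev (conj φ₁ φ₂) e ψ) → Ev φ₁ (lam e) (uimp φ₂ Ψ)
  ev_eval : ∀ (φ : Φ) (Ψ : Set Φ), ∀ ψ ∈ Ψ, Ev (conj (uimp φ Ψ) φ) eeval ψ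

namespace EvidencedFrame

variable (EF : EvidencedFrame.{u, v})

/-- `φ` is evidenceable if `⊤` entails it by some evidence. -/
def Evidenceable (φ : EF.Φ) : Prop := ∃ e, EF.Ev EF.top e φ

/-- `φ ⊃ ψ := φ ⊃ {ψ}`. -/
def imp (φ ψ : EF.Φ) : EF.Φ := EF.uimp φ {ψ}

/-- `φ ↭ ψ := (φ ⊃ ψ) ∧ (ψ ⊃ φ)`. -/
def biimp (φ ψ : EF.Φ) : EF.Φ := EF.conj (EF.imp φ ψ) (EF.imp ψ φ)

/-- `∏ Ψ := ⊤ ⊃ Ψ`. -/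
def prod (Ψ : Set EF.Φ) : EF.Φ := EF.uimp EF.top Ψ

/-- `∐ Ψ := ∏ {∏ {ψ ⊃ φ | ψ ∈ Ψ} ⊃ φ | φ ∈ Φ}`. -/
def coprod (Ψ : Set EF.Φ) : EF.Φ :=
  EF.prod {χ | ∃ φ : EF.Φ, χ = EF.imp (EF.prod {ξ | ∃ ψ ∈ Ψ, ξ = EF.imp ψ φ}) φ}

/-- `∏_{x ∈ X} φ x`. -/
def all {X : Type u} (φ : X → EF.Φ) : EF.Φ := EF.prod (Set.range φ)

/-- `∐_{x ∈ X} φ x`. -/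
def some {X : Type u} (φ : X → EF.Φ) : EF.Φ := EF.coprod (Set.range φ)

/-- The preorder on `I`-indexed predicates: entailment by one evidence for all indices. -/
def Ent {I : Type u} (θ φ : I → EF.Φ) : Prop := ∃ e, ∀ i, EF.Ev (θ i) e (φ i)

variable {EF}

section Logic

lemma ev_imp {θ φ ψ : EF.Φ} {e : EF.E} (h : EF.Ev (EF.conj θ φ) e ψ) :
    EF.Ev θ (EF.lam e) (EF.imp φ ψ) :=
  EF.ev_lam (by rintro _ rfl; exact h)

lemma ev_imp_elim {θ φ ψ : EF.Φ} {e : EF.E} (h : EF.Ev θ e (EF.imp φ ψ)) :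
    EF.Ev (EF.conj θ φ) (EF.seq (EF.pair (EF.seq EF.efst e) EF.esnd) EF.eeval) ψ :=
  EF.ev_seq (EF.ev_pair (EF.ev_seq (EF.ev_fst _ _) h) (EF.ev_snd _ _)) (EF.ev_eval _ _ _ rfl)

lemma ev_prod {θ : EF.Φ} {Ψ : Set EF.Φ} {e : EF.E} (h : ∀ ψ ∈ Ψ, EF.Ev θ e ψ) :
    EF.Ev θ (EF.lam (EF.seq EF.efst e)) (EF.prod Ψ) :=
  EF.ev_lam fun ψ hψ => EF.ev_seq (EF.ev_fst _ _) (h ψ hψ)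

lemma ev_prod_elim {θ : EF.Φ} {Ψ : Set EF.Φ} {e : EF.E} (h : EF.Ev θ e (EF.prod Ψ))
    {ψ : EF.Φ} (hψ : ψ ∈ Ψ) : EF.Ev θ (EF.seq (EF.pair e EF.etop) EF.eeval) ψ :=
  EF.ev_seq (EF.ev_pair h (EF.ev_top _)) (EF.ev_eval _ _ _ hψ)

lemma ev_all {X : Type u} {θ : EF.Φ} {φ : X → EF.Φ} {e : EF.E} (h : ∀ x, EF.Ev θ e (φ x)) :
    EF.Ev θ (EF.lam (EF.seq EF.efst e)) (EF.all φ) :=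
  ev_prod (by rintro _ ⟨x, rfl⟩; exact h x)

lemma ev_all_elim {X : Type u} {θ : EF.Φ} {φ : X → EF.Φ} {e : EF.E}
    (h : EF.Ev θ e (EF.all φ)) (x : X) :
    EF.Ev θ (EF.seq (EF.pair e EF.etop) EF.eeval) (φ x) :=
  ev_prod_elim h ⟨x, rfl⟩

variable {I J X Y Z W : Type u}

lemma Ent.refl (θ : I → EF.Φ) : EF.Ent θ θ := ⟨_, fun i => EF.ev_id _⟩

lemma Ent.trans {θ φ ψ : I → EF.Φ} : EF.Ent θ φ → EF.Ent φ ψ → EF.Ent θ ψ :=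
  fun ⟨_, h⟩ ⟨_, k⟩ => ⟨_, fun i => EF.ev_seq (h i) (k i)⟩

lemma Ent.pull {θ φ : I → EF.Φ} {θ' : J → EF.Φ} (h : EF.Ent θ φ) (r : J → I)
    (hr : EF.Ent θ' fun j => θ (r j)) : EF.Ent θ' fun j => φ (r j) :=
  hr.trans (h.imp fun _ he j => he (r j))

lemma Ent.top (θ : I → EF.Φ) : EF.Ent θ fun _ => EF.top := ⟨_, fun _ => EF.ev_top _⟩

lemma Ent.and {θ φ ψ : I → EF.Φ} :
    EF.Ent θ φ → EF.Ent θ ψ → EF.Ent θ fun i => EF.conj (φ i) (ψ i) :=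
  fun ⟨_, h⟩ ⟨_, k⟩ => ⟨_, fun i => EF.ev_pair (h i) (k i)⟩

lemma Ent.fst {θ φ ψ : I → EF.Φ} (h : EF.Ent θ fun i => EF.conj (φ i) (ψ i)) : EF.Ent θ φ :=
  h.trans ⟨_, fun _ => EF.ev_fst _ _⟩

lemma Ent.snd {θ φ ψ : I → EF.Φ} (h : EF.Ent θ fun i => EF.conj (φ i) (ψ i)) : EF.Ent θ ψ :=
  h.trans ⟨_, fun _ => EF.ev_snd _ _⟩

lemma Ent.imp {θ φ ψ : I → EF.Φ} (h : EF.Ent (fun i => EF.conj (θ i) (φ i)) ψ) :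
    EF.Ent θ fun i => EF.imp (φ i) (ψ i) :=
  let ⟨_, h⟩ := h
  ⟨_, fun i => ev_imp (h i)⟩

lemma Ent.mp {θ φ ψ : I → EF.Φ} (h : EF.Ent θ fun i => EF.imp (φ i) (ψ i)) (k : EF.Ent θ φ) :
    EF.Ent θ ψ :=
  let ⟨_, h⟩ := h
  ((Ent.refl θ).and k).trans ⟨_, fun i => ev_imp_elim (h i)⟩

lemma Ent.some_intro {θ : I → EF.Φ} {φ : I → X → EF.Φ} (x : I → X)
    (h : EF.Ent θ fun i => φ i (x i)) : EF.Ent θ fun i => EF.some (φ i) :=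
  h.trans ⟨_, fun i => ev_prod (by
    rintro _ ⟨ψ, rfl⟩
    exact ev_imp (EF.ev_seq (EF.ev_pair
      (EF.ev_seq (EF.ev_snd _ _) (ev_prod_elim (EF.ev_id _) ⟨_, ⟨x i, rfl⟩, rfl⟩))
      (EF.ev_fst _ _)) (EF.ev_eval _ _ _ rfl)))⟩

lemma Ent.some_elim {θ ψ : I → EF.Φ} {φ : I → X → EF.Φ} (h : EF.Ent θ fun i => EF.some (φ i))
    (k : ∀ {J : Type u} (θ' : J → EF.Φ) (r : J → I) (x : J → X), EF.Ent θ' (fun j => θ (r j)) →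
      EF.Ent θ' (fun j => φ (r j) (x j)) → EF.Ent θ' fun j => ψ (r j)) : EF.Ent θ ψ := by
  obtain ⟨e, he⟩ := k (J := I × X) (fun p => EF.conj (θ p.1) (φ p.1 p.2)) Prod.fst Prod.snd
    (Ent.refl _).fst (Ent.refl _).snd
  obtain ⟨e', he'⟩ := h
  have h1 : EF.Ent θ fun i => EF.imp
      (EF.prod {ξ | ∃ χ ∈ Set.range (φ i), ξ = EF.imp χ (ψ i)}) (ψ i) :=
    ⟨_, fun i => ev_prod_elim (he' i) ⟨_, rfl⟩⟩
  refine h1.mp ⟨EF.lam (EF.seq EF.efst (EF.lam e)), fun i => ev_prod ?_⟩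
  rintro _ ⟨_, ⟨x, rfl⟩, rfl⟩
  exact ev_imp (he (i, x))

lemma evid_one (A B : X → EF.Φ) :
    EF.Evidenceable (EF.all fun x => EF.imp (A x) (B x)) ↔
      ∀ {I : Type u} (θ : I → EF.Φ) (x : I → X),
        EF.Ent θ (fun i => A (x i)) → EF.Ent θ fun i => B (x i) := by
  constructor
  · rintro ⟨e, he⟩ I θ x h
    exact Ent.mp ((Ent.top θ).trans ⟨_, fun i => ev_all_elim he (x i)⟩) h
  · intro h
    obtain ⟨e, he⟩ := h (I := X) _ id (Ent.refl _)
    exact ⟨_, ev_all fun x => ev_imp (EF.ev_seq (EF.ev_snd _ _) (he x))⟩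

lemma evid_two (A B : X → Y → EF.Φ) :
    EF.Evidenceable (EF.all fun x => EF.all fun y => EF.imp (A x y) (B x y)) ↔
      ∀ {I : Type u} (θ : I → EF.Φ) (x : I → X) (y : I → Y),
        EF.Ent θ (fun i => A (x i) (y i)) → EF.Ent θ fun i => B (x i) (y i) := by
  constructor
  · rintro ⟨e, he⟩ I θ x y h
    exact Ent.mp ((Ent.top θ).trans ⟨_, fun i => ev_all_elim (ev_all_elim he (x i)) (y i)⟩) h
  · intro h
    obtain ⟨e, he⟩ := h (I := X × Y) _ Prod.fst Prod.snd (Ent.refl _)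
    exact ⟨_, ev_all fun x => ev_all fun y => ev_imp (EF.ev_seq (EF.ev_snd _ _) (he (x, y)))⟩

lemma evid_three (A B : X → Y → Z → EF.Φ) :
    EF.Evidenceable (EF.all fun x => EF.all fun y => EF.all fun z =>
        EF.imp (A x y z) (B x y z)) ↔
      ∀ {I : Type u} (θ : I → EF.Φ) (x : I → X) (y : I → Y) (z : I → Z),
        EF.Ent θ (fun i => A (x i) (y i) (z i)) → EF.Ent θ fun i => B (x i) (y i) (z i) := by
  constructor
  · rintro ⟨e, he⟩ I θ x y z h
    exact Ent.mp ((Ent.top θ).trans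
      ⟨_, fun i => ev_all_elim (ev_all_elim (ev_all_elim he (x i)) (y i)) (z i)⟩) h
  · intro h
    obtain ⟨e, he⟩ := h (I := X × Y × Z) _ (·.1) (·.2.1) (·.2.2) (Ent.refl _)
    exact ⟨_, ev_all fun x => ev_all fun y => ev_all fun z =>
      ev_imp (EF.ev_seq (EF.ev_snd _ _) (he (x, y, z)))⟩

lemma evid_four (A B : X → Y → Z → W → EF.Φ) :
    EF.Evidenceable (EF.all fun x => EF.all fun y => EF.all fun z => EF.all fun w =>
        EF.imp (A x y z w) (B x y z w)) ↔
      ∀ {I : Type u} (θ : I → EF.Φ) (x : I → X) (y : I → Y) (z : I → Z) (w : I → W),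
        EF.Ent θ (fun i => A (x i) (y i) (z i) (w i)) →
          EF.Ent θ fun i => B (x i) (y i) (z i) (w i) := by
  constructor
  · rintro ⟨e, he⟩ I θ x y z w h
    exact Ent.mp ((Ent.top θ).trans ⟨_, fun i => ev_all_elim (ev_all_elim
      (ev_all_elim (ev_all_elim he (x i)) (y i)) (z i)) (w i)⟩) h
  · intro h
    obtain ⟨e, he⟩ := h (I := X × Y × Z × W) _ (·.1) (·.2.1) (·.2.2.1) (·.2.2.2) (Ent.refl _)
    exact ⟨_, ev_all fun x => ev_all fun y => ev_all fun z => ev_all fun w =>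
      ev_imp (EF.ev_seq (EF.ev_snd _ _) (he (x, y, z, w)))⟩

end Logic

end EvidencedFrame

/-- Objects of `EFT EF`: a set with an equality predicate, i.e. an evidenceably symmetric and
transitive binary predicate. -/
structure EFT (EF : EvidencedFrame.{u, v}) where
  carrier : Type u
  eqv : carrier → carrier → EF.Φ
  sym : EF.Evidenceable (EF.all fun x => EF.all fun y => EF.imp (eqv x y) (eqv y x))
  trs : EF.Evidenceable (EF.all fun x => EF.all fun y => EF.all fun z =>
    EF.imp (EF.conj (eqv x y) (eqv y z)) (eqv x z))

namespace EFT

open EvidencedFrame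

variable {EF : EvidencedFrame.{u, v}}

/-- The existence predicate `ex(x) := x ∼ x`. -/
def ex (X : EFT EF) (x : X.carrier) : EF.Φ := X.eqv x x

section

variable {X : EFT EF} {I : Type u} {θ : I → EF.Φ}

lemma ent_symm {x y : I → X.carrier} (h : EF.Ent θ fun i => X.eqv (x i) (y i)) :
    EF.Ent θ fun i => X.eqv (y i) (x i) :=
  (evid_two _ _).1 X.sym θ x y h

lemma ent_trans {x y z : I → X.carrier} (h : EF.Ent θ fun i => X.eqv (x i) (y i))
    (k : EF.Ent θ fun i => X.eqv (y i) (z i)) : EF.Ent θ fun i => X.eqv (x i) (z i) :=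
  (evid_three _ _).1 X.trs θ x y z (h.and k)

lemma ent_left {x y : I → X.carrier} (h : EF.Ent θ fun i => X.eqv (x i) (y i)) :
    EF.Ent θ fun i => X.ex (x i) :=
  ent_trans h (ent_symm h)

lemma ent_right {x y : I → X.carrier} (h : EF.Ent θ fun i => X.eqv (x i) (y i)) :
    EF.Ent θ fun i => X.ex (y i) :=
  ent_trans (ent_symm h) h

end

/-- Functional predicates `X → Y`: extensional, single-valued and total. -/
structure FunPred (X Y : EFT EF) where
  rel : X.carrier → Y.carrier → EF.Φ
  ext : EF.Evidenceable (EF.all fun x => EF.all fun x' => EF.all fun y => EF.all fun y' =>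
    EF.imp (EF.conj (EF.conj (X.eqv x x') (Y.eqv y y')) (rel x y)) (rel x' y'))
  sv : EF.Evidenceable (EF.all fun x => EF.all fun y => EF.all fun y' =>
    EF.imp (EF.conj (EF.conj (EF.conj (EF.conj (X.ex x) (Y.ex y)) (Y.ex y')) (rel x y)) (rel x y'))
      (Y.eqv y y'))
  tot : EF.Evidenceable (EF.all fun x =>
    EF.imp (X.ex x) (EF.some fun y => EF.conj (Y.ex y) (rel x y)))

namespace FunPred

variable {X Y Z W : EFT EF}

section

variable (F : FunPred X Y) {I : Type u} {θ : I → EF.Φ}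

lemma ent_ext {x x' : I → X.carrier} {y y' : I → Y.carrier}
    (hx : EF.Ent θ fun i => X.eqv (x i) (x' i)) (hy : EF.Ent θ fun i => Y.eqv (y i) (y' i))
    (h : EF.Ent θ fun i => F.rel (x i) (y i)) : EF.Ent θ fun i => F.rel (x' i) (y' i) :=
  (evid_four _ _).1 F.ext θ x x' y y' ((hx.and hy).and h)

lemma ent_sv {x : I → X.carrier} {y y' : I → Y.carrier}
    (hx : EF.Ent θ fun i => X.ex (x i)) (hy : EF.Ent θ fun i => Y.ex (y i))
    (hy' : EF.Ent θ fun i => Y.ex (y' i)) (h : EF.Ent θ fun i => F.rel (x i) (y i))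
    (h' : EF.Ent θ fun i => F.rel (x i) (y' i)) : EF.Ent θ fun i => Y.eqv (y i) (y' i) :=
  (evid_three _ _).1 F.sv θ x y y' ((((hx.and hy).and hy').and h).and h')

lemma ent_tot {x : I → X.carrier} (hx : EF.Ent θ fun i => X.ex (x i)) :
    EF.Ent θ fun i => EF.some fun y => EF.conj (Y.ex y) (F.rel (x i) y) :=
  (evid_one _ _).1 F.tot θ x hx

end

/-- Functional predicates `F`, `G` are equivalent if
`eq(F, G) := ∏_x ∏_y (ex(x, y) ⊃ (F(x, y) ↭ G(x, y)))` is evidenceable. -/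
def Equiv (F G : FunPred X Y) : Prop :=
  EF.Evidenceable (EF.all fun x => EF.all fun y =>
    EF.imp (EF.conj (X.ex x) (Y.ex y)) (EF.biimp (F.rel x y) (G.rel x y)))

lemma Equiv.ent {F G : FunPred X Y} (h : F.Equiv G) {I : Type u} {θ : I → EF.Φ}
    {x : I → X.carrier} {y : I → Y.carrier}
    (hx : EF.Ent θ fun i => X.ex (x i)) (hy : EF.Ent θ fun i => Y.ex (y i))
    (hF : EF.Ent θ fun i => F.rel (x i) (y i)) : EF.Ent θ fun i => G.rel (x i) (y i) :=
  ((evid_two _ _).1 h θ x y (hx.and hy)).fst.mp hF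

lemma Equiv.symm {F G : FunPred X Y} (h : F.Equiv G) : G.Equiv F :=
  (evid_two _ _).2 fun θ x y hxy =>
    have k := (evid_two _ _).1 h θ x y hxy
    k.snd.and k.fst

/-- One entailment between functional predicates suffices for their equivalence. -/
lemma Equiv.of_ent {F G : FunPred X Y}
    (h : ∀ {I : Type u} (θ : I → EF.Φ) (x : I → X.carrier) (y : I → Y.carrier),
      EF.Ent θ (fun i => X.ex (x i)) → EF.Ent θ (fun i => Y.ex (y i)) →
      EF.Ent θ (fun i => F.rel (x i) (y i)) → EF.Ent θ fun i => G.rel (x i) (y i)) :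
    F.Equiv G := by
  refine (evid_two _ _).2 fun θ x y hxy => ?_
  refine Ent.and (Ent.imp ?_) (Ent.imp ?_)
  · have k := (Ent.refl (fun i => EF.conj (θ i) (F.rel (x i) (y i))))
    exact h _ _ _ (hxy.fst.pull id k.fst) (hxy.snd.pull id k.fst) k.snd
  · have k := (Ent.refl (fun i => EF.conj (θ i) (G.rel (x i) (y i))))
    have hx := hxy.fst.pull id k.fst
    have hy := hxy.snd.pull id k.fst
    refine (F.ent_tot hx).some_elim fun θ' r z hr hz => ?_
    have hx' := hx.pull r hr
    have hGz := h _ _ _ hx' hz.fst hz.snd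
    exact F.ent_ext hx' (G.ent_sv hx' hz.fst (hy.pull r hr) hGz (k.snd.pull r hr)) hz.snd

lemma Equiv.refl (F : FunPred X Y) : F.Equiv F := Equiv.of_ent fun _ _ _ _ _ h => h

lemma Equiv.trans {F G H : FunPred X Y} (h : F.Equiv G) (k : G.Equiv H) : F.Equiv H :=
  Equiv.of_ent fun _ _ _ hx hy hF => k.ent hx hy (h.ent hx hy hF)

instance setoid (X Y : EFT EF) : Setoid (FunPred X Y) where
  r := Equiv
  iseqv := ⟨Equiv.refl, Equiv.symm, Equiv.trans⟩

/-- The lifting `(x, y) ↦ f(x) ∼ y` of an extensional function `f`. -/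
def lift (f : X.carrier → Y.carrier)
    (hf : EF.Evidenceable (EF.all fun x => EF.all fun x' =>
      EF.imp (X.eqv x x') (Y.eqv (f x) (f x')))) : FunPred X Y where
  rel x y := Y.eqv (f x) y
  ext := (evid_four _ _).2 fun θ x x' _ _ h =>
    ent_trans (ent_trans (ent_symm ((evid_two _ _).1 hf θ x x' h.fst.fst)) h.snd) h.fst.snd
  sv := (evid_three _ _).2 fun _ _ _ _ h => ent_trans (ent_symm h.fst.snd) h.snd
  tot := (evid_one _ _).2 fun θ x h =>
    have k := (evid_two _ _).1 hf θ x x h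
    Ent.some_intro (φ := fun i y => EF.conj (Y.ex y) (Y.eqv (f (x i)) y)) (fun i => f (x i))
      (k.and k)

/-- Composition: `(G ∘ F)(x, z) := ∐_y (ex(y) ∧ F(x, y) ∧ G(y, z))`. -/
def comp (F : FunPred X Y) (G : FunPred Y Z) : FunPred X Z where
  rel x z := EF.some fun y => EF.conj (EF.conj (Y.ex y) (F.rel x y)) (G.rel y z)
  ext := (evid_four _ _).2 fun θ x x' z z' h => h.snd.some_elim fun θ' r y hr k =>
    Ent.some_intro (φ := fun j y =>
        EF.conj (EF.conj (Y.ex y) (F.rel (x' (r j)) y)) (G.rel y (z' (r j)))) y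
      ((k.fst.fst.and (F.ent_ext (h.fst.fst.pull r hr) k.fst.fst k.fst.snd)).and
        (G.ent_ext k.fst.fst (h.fst.snd.pull r hr) k.snd))
  sv := (evid_three _ _).2 fun θ x z z' h => h.snd.some_elim fun θ' r y hr k =>
    have h1 := h.fst.snd.pull r hr
    h1.some_elim fun θ'' s w hs l =>
      have hx := (h.fst.fst.fst.fst.pull r hr).pull s hs
      have hz := (h.fst.fst.fst.snd.pull r hr).pull s hs
      have hz' := (h.fst.fst.snd.pull r hr).pull s hs
      have k := k.pull s hs
      have hw := F.ent_sv hx l.fst.fst k.fst.fst l.fst.snd k.fst.snd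
      G.ent_sv k.fst.fst hz hz' (G.ent_ext hw hz l.snd) k.snd
  tot := (evid_one _ _).2 fun θ x h => (F.ent_tot h).some_elim fun θ' r y hr k =>
    (G.ent_tot k.fst).some_elim fun θ'' s z hs l =>
      Ent.some_intro (φ := fun j z => EF.conj (Z.ex z)
          (EF.some fun y => EF.conj (EF.conj (Y.ex y) (F.rel (x (r (s j))) y)) (G.rel y z))) z
        (l.fst.and (Ent.some_intro (φ := fun j y =>
            EF.conj (EF.conj (Y.ex y) (F.rel (x (r (s j))) y)) (G.rel y (z j))) (fun j => y (s j))
          ((k.pull s hs).and l.snd)))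

lemma ent_comp {F : FunPred X Y} {G : FunPred Y Z} {I : Type u} {θ : I → EF.Φ}
    {x : I → X.carrier} {z : I → Z.carrier} (y : I → Y.carrier)
    (hy : EF.Ent θ fun i => Y.ex (y i)) (hF : EF.Ent θ fun i => F.rel (x i) (y i))
    (hG : EF.Ent θ fun i => G.rel (y i) (z i)) : EF.Ent θ fun i => (F.comp G).rel (x i) (z i) :=
  Ent.some_intro (φ := fun i y =>
    EF.conj (EF.conj (Y.ex y) (F.rel (x i) y)) (G.rel y (z i))) y ((hy.and hF).and hG)

lemma comp_congr {F F' : FunPred X Y} {G G' : FunPred Y Z} (h : F.Equiv F') (k : G.Equiv G') :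
    (F.comp G).Equiv (F'.comp G') :=
  Equiv.of_ent fun θ x z hx hz l => l.some_elim fun θ' r y hr l =>
    ent_comp y l.fst.fst (h.ent (hx.pull r hr) l.fst.fst l.fst.snd)
      (k.ent l.fst.fst (hz.pull r hr) l.snd)

/-- The identity functional predicate, the lifting of the identity function. -/
def id (X : EFT EF) : FunPred X X := lift (fun x => x) ((evid_two _ _).2 fun _ _ _ h => h)

lemma id_comp (F : FunPred X Y) : ((id X).comp F).Equiv F :=
  Equiv.of_ent fun θ x y hx hy l => l.some_elim fun θ' r z hr l =>
    F.ent_ext (ent_symm l.fst.snd) (hy.pull r hr) l.snd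

lemma comp_id (F : FunPred X Y) : (F.comp (id Y)).Equiv F :=
  Equiv.of_ent fun θ x y hx hy l => l.some_elim fun θ' r z hr l =>
    F.ent_ext (hx.pull r hr) l.snd l.fst.snd

lemma assoc (F : FunPred X Y) (G : FunPred Y Z) (H : FunPred Z W) :
    ((F.comp G).comp H).Equiv (F.comp (G.comp H)) :=
  Equiv.of_ent fun θ x w hx hw l => l.some_elim fun θ' r z hr l =>
    have m : EF.Ent θ' _ := l.fst.snd
    m.some_elim fun θ'' s y hs m =>
      ent_comp y m.fst.fst m.fst.snd
        (ent_comp (fun j => z (s j)) (l.fst.fst.pull s hs) m.snd (l.snd.pull s hs))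

end FunPred

/-- The category `EFT EF`: morphisms are equivalence classes of functional predicates. -/
instance category : Category.{u} (EFT EF) where
  Hom X Y := Quotient (FunPred.setoid X Y)
  id X := Quotient.mk _ (FunPred.id X)
  comp f g := Quotient.map₂ FunPred.comp
    (fun _ _ h _ _ k => FunPred.comp_congr h k) f g
  id_comp := by rintro X Y ⟨F⟩; exact Quotient.sound F.id_comp
  comp_id := by rintro X Y ⟨F⟩; exact Quotient.sound F.comp_id
  assoc := by rintro X Y Z W ⟨F⟩ ⟨G⟩ ⟨H⟩; exact Quotient.sound (F.assoc G H)

/-- The morphism represented by a functional predicate. -/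
def homMk {X Y : EFT EF} (F : FunPred X Y) : X ⟶ Y := Quotient.mk (FunPred.setoid X Y) F

/-- The object `(𝟙, 𝟏)`: a one-point set with the constant predicate `⊤`. -/
def one (EF : EvidencedFrame.{u, v}) : EFT EF where
  carrier := PUnit
  eqv _ _ := EF.top
  sym := (evid_two _ _).2 fun θ _ _ _ => Ent.top θ
  trs := (evid_three _ _).2 fun θ _ _ _ _ => Ent.top θ

/-- The morphism `X ⟶ (𝟙, 𝟏)` represented by the constant function. -/
def toOne (X : EFT EF) : X ⟶ one EF :=
  homMk (FunPred.lift (fun _ => PUnit.unit) ((evid_two _ _).2 fun θ _ _ _ => Ent.top θ))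

/-- The product object: `(x, y) ∼ (x', y') := x ∼ x' ∧ y ∼ y'` on `X × Y`. -/
def prod (X Y : EFT EF) : EFT EF where
  carrier := X.carrier × Y.carrier
  eqv p q := EF.conj (X.eqv p.1 q.1) (Y.eqv p.2 q.2)
  sym := (evid_two _ _).2 fun _ _ _ h => (ent_symm h.fst).and (ent_symm h.snd)
  trs := (evid_three _ _).2 fun _ _ _ _ h =>
    (ent_trans h.fst.fst h.snd.fst).and (ent_trans h.fst.snd h.snd.snd)

/-- The projections, represented by the projection functions. -/
def fst (X Y : EFT EF) : prod X Y ⟶ X :=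
  homMk (FunPred.lift Prod.fst ((evid_two _ _).2 fun _ _ _ h => h.fst))

/-- The second projection. -/
def snd (X Y : EFT EF) : prod X Y ⟶ Y :=
  homMk (FunPred.lift Prod.snd ((evid_two _ _).2 fun _ _ _ h => h.snd))

/-- The pairing `⟨F, G⟩(w, (x, y)) := F(w, x) ∧ G(w, y)` of functional predicates. -/
def FunPred.pair {W X Y : EFT EF} (F : FunPred W X) (G : FunPred W Y) :
    FunPred W (prod X Y) where
  rel w p := EF.conj (F.rel w p.1) (G.rel w p.2)
  ext := (evid_four _ _).2 fun _ _ _ _ _ h =>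
    (F.ent_ext h.fst.fst h.fst.snd.fst h.snd.fst).and (G.ent_ext h.fst.fst h.fst.snd.snd h.snd.snd)
  sv := (evid_three _ _).2 fun θ w p q h =>
    have hp := h.fst.fst.fst.snd
    have hq := h.fst.fst.snd
    have hw := h.fst.fst.fst.fst
    (F.ent_sv hw hp.fst hq.fst h.fst.snd.fst h.snd.fst).and
      (G.ent_sv hw hp.snd hq.snd h.fst.snd.snd h.snd.snd)
  tot := (evid_one _ _).2 fun θ w h => (F.ent_tot h).some_elim fun θ' r x hr k =>
    (G.ent_tot (h.pull r hr)).some_elim fun θ'' s y hs l =>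
      Ent.some_intro (φ := fun j p => EF.conj ((prod X Y).ex p)
          (EF.conj (F.rel (w (r (s j))) p.1) (G.rel (w (r (s j))) p.2))) (fun j => (x (s j), y j))
        (((k.fst.pull s hs).and l.fst).and ((k.snd.pull s hs).and l.snd))

/-- The equalizer object of `[F]`, `[G]`: the set `X` with
`x ≈ x' := x ∼ x' ∧ ∐_y (ex(y) ∧ F(x, y) ∧ G(x, y))`. -/
def equalizer {X Y : EFT EF} (F G : FunPred X Y) : EFT EF where
  carrier := X.carrier
  eqv x x' := EF.conj (X.eqv x x')
    (EF.some fun y => EF.conj (EF.conj (Y.ex y) (F.rel x y)) (G.rel x y))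
  sym := (evid_two _ _).2 fun θ x x' h => (ent_symm h.fst).and
    (h.snd.some_elim fun θ' r y hr k =>
      have hx := h.fst.pull r hr
      Ent.some_intro (φ := fun j y =>
          EF.conj (EF.conj (Y.ex y) (F.rel (x' (r j)) y)) (G.rel (x' (r j)) y)) y
        ((k.fst.fst.and (F.ent_ext hx k.fst.fst k.fst.snd)).and (G.ent_ext hx k.fst.fst k.snd)))
  trs := (evid_three _ _).2 fun _ _ _ _ h => (ent_trans h.fst.fst h.snd.fst).and h.fst.snd

/-- The inclusion of the equalizer object, represented by the identity function. -/
def equalizerι {X Y : EFT EF} (F G : FunPred X Y) : equalizer F G ⟶ X :=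
  homMk (FunPred.lift (X := equalizer F G) (fun x => x) ((evid_two _ _).2 fun _ _ _ h => h.fst))

/-- The object of truth values `(Φ, ↭)`. -/
def Omega (EF : EvidencedFrame.{u, v}) : EFT EF where
  carrier := EF.Φ
  eqv := EF.biimp
  sym := (evid_two _ _).2 fun _ _ _ h => h.snd.and h.fst
  trs := (evid_three _ _).2 fun θ x _ z h => by
    refine Ent.and (Ent.imp ?_) (Ent.imp ?_)
    · have k := Ent.refl (fun i => EF.conj (θ i) (x i))
      have l := h.pull (fun i => i) k.fst
      exact l.snd.fst.mp (l.fst.fst.mp k.snd)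
    · have k := Ent.refl (fun i => EF.conj (θ i) (z i))
      have l := h.pull (fun i => i) k.fst
      exact l.fst.snd.mp (l.snd.snd.mp k.snd)

/-- The morphism `true`, represented by the function `∗ ↦ ⊤`. -/
def true (EF : EvidencedFrame.{u, v}) : one EF ⟶ Omega EF :=
  homMk (FunPred.lift (X := one EF) (Y := Omega EF) (fun _ => EF.top)
    ((evid_two _ _).2 fun _ _ _ _ => Ent.and (Ent.imp (Ent.top _)) (Ent.imp (Ent.top _))))

end EFT

/-- An elementary topos: a category with finite limits that is cartesian closed and has a
subobject classifier. -/
structure IsElementaryTopos (C : Type*) [Category* C] : Prop where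
  hasFiniteLimits : HasFiniteLimits C
  cartesianClosed : ∃ _ : CartesianMonoidalCategory C, Nonempty (MonoidalClosed C)
  hasSubobjectClassifier : HasSubobjectClassifier C

/-!
A proof in `EFT EF` is an argument in the internal first-order logic of `EF`, carried out on
generalized elements: an entailment `Ent θ φ` between `I`-indexed families plays the role of
"in context `θ`, `φ` holds of the `I`-indexed elements", and reindexing along `J → I` stands for
introducing fresh variables. `Ent.some_elim` and `ent_all_imp_iff` are the rules for the quantifiers.

The limits rest on two facts. A functional predicate represents a monomorphism exactly when it is
internally injective (`FunPred.Injective.mono`, `FunPred.injective_of_mono`, the latter by testing on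
the kernel pair). A morphism whose values lie in the image of an injective functional predicate
factors through it, by unique choice of the preimage (`FunPred.factor_comp`). The universal
properties of the equalizer and of the pullback of `true` both follow from this factorization.

The exponential of `Y` by `X` has all relations `X → Y → Φ` as its elements, and its equality
predicate demands that both sides are functional and that they agree on existing elements. The
transpose of `H` relates `w` to the relations agreeing with `H((-, w), -)`; `curry_eval` and
`eq_curry` are its existence and uniqueness.

For the subobject classifier, `isPullback_true_iff` shows that a functional predicate `C` into
`(Φ, ↭)` classifies the monomorphism `[F]` if and only if `C(x, ⊤)` is equivalent to `x` lying in
the image of `F`. The function sending `x` to the proposition "`x` is in the image" has this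
property, and extensionality and single-valuedness of `C` recover all of `C` from its values at `⊤`.
-/

namespace EvidencedFrame

variable {EF : EvidencedFrame.{u, v}} {I J X : Type u}

/-! ### Internal universal quantification and biimplication -/

/-- The universal property of `∏_x (A x ⊃ B x)` in context `θ`: it is entailed by `θ` exactly when,
after every reindexing of `θ` and at every generalized element of `X`, `A` entails `B`. -/
lemma ent_all_imp_iff {θ : I → EF.Φ} {A B : I → X → EF.Φ} :
    EF.Ent θ (fun i => EF.all fun x => EF.imp (A i x) (B i x)) ↔
      ∀ {J : Type u} (θ' : J → EF.Φ) (r : J → I) (x : J → X), EF.Ent θ' (fun j => θ (r j)) →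
        EF.Ent θ' (fun j => A (r j) (x j)) → EF.Ent θ' fun j => B (r j) (x j) := by
  constructor
  · rintro ⟨e, he⟩ J θ' r x hr hA
    have h : EF.Ent (fun j => θ (r j)) fun j => EF.imp (A (r j) (x j)) (B (r j) (x j)) :=
      ⟨_, fun j => ev_all_elim (he (r j)) (x j)⟩
    exact (hr.trans h).mp hA
  · intro h
    obtain ⟨e, he⟩ := h (J := I × X) (fun p => EF.conj (θ p.1) (A p.1 p.2)) Prod.fst Prod.snd
      (Ent.refl _).fst (Ent.refl _).snd
    exact ⟨_, fun i => ev_all fun x => ev_imp (he (i, x))⟩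

lemma Ent.imp_intro {θ φ ψ : I → EF.Φ}
    (h : ∀ θ' : I → EF.Φ, EF.Ent θ' θ → EF.Ent θ' φ → EF.Ent θ' ψ) :
    EF.Ent θ fun i => EF.imp (φ i) (ψ i) :=
  Ent.imp (h _ (Ent.refl _).fst (Ent.refl _).snd)

lemma Ent.biimp_intro {θ φ ψ : I → EF.Φ}
    (h : ∀ θ' : I → EF.Φ, EF.Ent θ' θ → EF.Ent θ' φ → EF.Ent θ' ψ)
    (k : ∀ θ' : I → EF.Φ, EF.Ent θ' θ → EF.Ent θ' ψ → EF.Ent θ' φ) :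
    EF.Ent θ fun i => EF.biimp (φ i) (ψ i) :=
  (Ent.imp_intro h).and (Ent.imp_intro k)

end EvidencedFrame

namespace EFT

open EvidencedFrame

variable {EF : EvidencedFrame.{u, v}}

/-! ### Representatives of morphisms -/

section

variable {X Y Z W S : EFT EF}

lemma homMk_eq_iff {F G : FunPred X Y} : homMk F = homMk G ↔ F.Equiv G := Quotient.eq

lemma homMk_comp (F : FunPred X Y) (G : FunPred Y Z) :
    homMk F ≫ homMk G = homMk (F.comp G) := rfl

lemma exists_homMk (f : X ⟶ Y) : ∃ F : FunPred X Y, homMk F = f := Quotient.exists_rep f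

namespace FunPred

/-- Existential elimination for a composite. -/
lemma ent_comp_elim {F : FunPred X Y} {G : FunPred Y Z} {I : Type u} {θ ψ : I → EF.Φ}
    {x : I → X.carrier} {z : I → Z.carrier}
    (h : EF.Ent θ fun i => (F.comp G).rel (x i) (z i))
    (k : ∀ {J : Type u} (θ' : J → EF.Φ) (r : J → I) (y : J → Y.carrier),
      EF.Ent θ' (fun j => θ (r j)) → EF.Ent θ' (fun j => Y.ex (y j)) →
      EF.Ent θ' (fun j => F.rel (x (r j)) (y j)) → EF.Ent θ' (fun j => G.rel (y j) (z (r j))) →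
      EF.Ent θ' fun j => ψ (r j)) : EF.Ent θ ψ :=
  h.some_elim fun θ' r y hr l => k θ' r y hr l.fst.fst l.fst.snd l.snd

/-- Existential elimination for totality. -/
lemma ent_tot_elim (F : FunPred X Y) {I : Type u} {θ ψ : I → EF.Φ} {x : I → X.carrier}
    (h : EF.Ent θ fun i => X.ex (x i))
    (k : ∀ {J : Type u} (θ' : J → EF.Φ) (r : J → I) (y : J → Y.carrier),
      EF.Ent θ' (fun j => θ (r j)) → EF.Ent θ' (fun j => Y.ex (y j)) →
      EF.Ent θ' (fun j => F.rel (x (r j)) (y j)) → EF.Ent θ' fun j => ψ (r j)) : EF.Ent θ ψ :=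
  (F.ent_tot h).some_elim fun θ' r y hr l => k θ' r y hr l.fst l.snd

/-! ### Monomorphisms and images -/

/-- Internal injectivity: elements with a common value are equal, tested on generalized elements. -/
def Injective (F : FunPred S X) : Prop :=
  ∀ ⦃I : Type u⦄ (θ : I → EF.Φ) (s s' : I → S.carrier) (x : I → X.carrier),
    EF.Ent θ (fun i => S.ex (s i)) → EF.Ent θ (fun i => S.ex (s' i)) →
    EF.Ent θ (fun i => X.ex (x i)) → EF.Ent θ (fun i => F.rel (s i) (x i)) →
    EF.Ent θ (fun i => F.rel (s' i) (x i)) → EF.Ent θ fun i => S.eqv (s i) (s' i)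

/-- The internal image of `F`: `x` is the value of some existing `s`. -/
def image (F : FunPred S X) (x : X.carrier) : EF.Φ :=
  EF.some fun s => EF.conj (S.ex s) (F.rel s x)

lemma ent_image {F : FunPred S X} {I : Type u} {θ : I → EF.Φ} {x : I → X.carrier}
    (s : I → S.carrier) (hs : EF.Ent θ fun i => S.ex (s i))
    (h : EF.Ent θ fun i => F.rel (s i) (x i)) : EF.Ent θ fun i => F.image (x i) :=
  Ent.some_intro (φ := fun i s => EF.conj (S.ex s) (F.rel s (x i))) s (hs.and h)

lemma ent_image_elim {F : FunPred S X} {I : Type u} {θ ψ : I → EF.Φ} {x : I → X.carrier}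
    (h : EF.Ent θ fun i => F.image (x i))
    (k : ∀ {J : Type u} (θ' : J → EF.Φ) (r : J → I) (s : J → S.carrier),
      EF.Ent θ' (fun j => θ (r j)) → EF.Ent θ' (fun j => S.ex (s j)) →
      EF.Ent θ' (fun j => F.rel (s j) (x (r j))) → EF.Ent θ' fun j => ψ (r j)) : EF.Ent θ ψ :=
  h.some_elim fun θ' r s hr l => k θ' r s hr l.fst l.snd

lemma ent_image_congr (F : FunPred S X) {I : Type u} {θ : I → EF.Φ} {x x' : I → X.carrier}
    (hx : EF.Ent θ fun i => X.eqv (x i) (x' i)) (h : EF.Ent θ fun i => F.image (x i)) :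
    EF.Ent θ fun i => F.image (x' i) :=
  ent_image_elim h fun θ' r s hr hs l => ent_image s hs (F.ent_ext hs (hx.pull r hr) l)

lemma Injective.mono {F : FunPred S X} (hF : F.Injective) : Mono (homMk F) where
  right_cancellation := by
    intro W a b h
    obtain ⟨A, rfl⟩ := exists_homMk a
    obtain ⟨B, rfl⟩ := exists_homMk b
    rw [homMk_comp, homMk_comp, homMk_eq_iff] at h
    refine homMk_eq_iff.2 (Equiv.of_ent fun θ w s hw hs hA => ?_)
    refine F.ent_tot_elim hs fun θ' r x hr hx hF' => ?_
    have hAF := ent_comp (F := A) (fun j => s (r j)) (hs.pull r hr) (hA.pull r hr) hF'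
    have hBF := h.ent (hw.pull r hr) hx hAF
    refine ent_comp_elim hBF fun θ'' t s' ht hs' hB hF'' => ?_
    exact B.ent_ext ((hw.pull r hr).pull t ht)
      (hF _ _ _ _ hs' ((hs.pull r hr).pull t ht) (hx.pull t ht) hF'' (hF'.pull t ht)) hB

/-- The factorization of `H` through an injective `F` whose image contains the values of `H`:
unique choice of the preimage, `(w, s) ↦ ∐_x (ex(x) ∧ H(w, x) ∧ F(s, x))`. -/
def factor (H : FunPred W X) (F : FunPred S X) (hF : F.Injective)
    (hH : ∀ ⦃I : Type u⦄ (θ : I → EF.Φ) (w : I → W.carrier) (x : I → X.carrier),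
      EF.Ent θ (fun i => W.ex (w i)) → EF.Ent θ (fun i => X.ex (x i)) →
      EF.Ent θ (fun i => H.rel (w i) (x i)) → EF.Ent θ fun i => F.image (x i)) :
    FunPred W S where
  rel w s := EF.some fun x => EF.conj (EF.conj (X.ex x) (H.rel w x)) (F.rel s x)
  ext := (evid_four _ _).2 fun θ w w' s s' h => h.snd.some_elim fun θ' r x hr l =>
    have h := h.fst.pull r hr
    Ent.some_intro (φ := fun j x =>
        EF.conj (EF.conj (X.ex x) (H.rel (w' (r j)) x)) (F.rel (s' (r j)) x)) x
      ((l.fst.fst.and (H.ent_ext h.fst l.fst.fst l.fst.snd)).and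
        (F.ent_ext h.snd l.fst.fst l.snd))
  sv := (evid_three _ _).2 fun θ w s s' h => h.snd.some_elim fun θ' r x hr l => by
    have h := h.fst.pull r hr
    refine h.snd.some_elim fun θ'' t y ht m => ?_
    have h := h.fst.pull t ht
    have l := l.pull t ht
    have e := H.ent_sv h.fst.fst m.fst.fst l.fst.fst m.fst.snd l.fst.snd
    exact hF _ _ _ _ h.fst.snd h.snd l.fst.fst (F.ent_ext h.fst.snd e m.snd) l.snd
  tot := (evid_one _ _).2 fun θ w h => H.ent_tot_elim h fun θ' r x hr hx hHx =>
    ent_image_elim (hH θ' _ x (h.pull r hr) hx hHx) fun θ'' t s ht hs l =>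
      Ent.some_intro (φ := fun j s => EF.conj (S.ex s) (EF.some fun x =>
          EF.conj (EF.conj (X.ex x) (H.rel (w (r (t j))) x)) (F.rel s x))) s
        (hs.and (Ent.some_intro (φ := fun j x =>
            EF.conj (EF.conj (X.ex x) (H.rel (w (r (t j))) x)) (F.rel (s j) x))
          (fun j => x (t j)) (((hx.pull t ht).and (hHx.pull t ht)).and l)))

lemma factor_comp (H : FunPred W X) (F : FunPred S X) (hF : F.Injective) (hH) :
    homMk (H.factor F hF hH) ≫ homMk F = homMk H :=
  homMk_eq_iff.2 <| Equiv.of_ent fun θ w x hw hx h =>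
    ent_comp_elim h fun θ' r s hr hs l hsx => by
      have l : EF.Ent θ' fun j => EF.some fun x =>
        EF.conj (EF.conj (X.ex x) (H.rel (w (r j)) x)) (F.rel (s j) x) := l
      exact l.some_elim fun θ'' t y ht m =>
        H.ent_ext ((hw.pull r hr).pull t ht)
          (F.ent_sv (hs.pull t ht) m.fst.fst ((hx.pull r hr).pull t ht) m.snd (hsx.pull t ht))
          m.fst.snd

end FunPred

/-! ### Terminal object, binary products and equalizers -/

lemma eq_toOne (f : X ⟶ one EF) : f = toOne X := by
  obtain ⟨F, rfl⟩ := exists_homMk f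
  exact homMk_eq_iff.2 (FunPred.Equiv.of_ent fun θ _ _ _ _ _ => Ent.top θ)

variable (EF) in
/-- `one EF` is terminal. -/
def oneIsTerminal : IsTerminal (one EF) := IsTerminal.ofUniqueHom toOne fun _ => eq_toOne

lemma pair_fst (F : FunPred W X) (G : FunPred W Y) :
    homMk (F.pair G) ≫ fst X Y = homMk F :=
  homMk_eq_iff.2 <| FunPred.Equiv.of_ent fun θ w x hw hx h =>
    FunPred.ent_comp_elim h fun θ' r p hr hp l m =>
      F.ent_ext (hw.pull r hr) m l.fst

lemma pair_snd (F : FunPred W X) (G : FunPred W Y) :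
    homMk (F.pair G) ≫ snd X Y = homMk G :=
  homMk_eq_iff.2 <| FunPred.Equiv.of_ent fun θ w y hw hy h =>
    FunPred.ent_comp_elim h fun θ' r p hr hp l m =>
      G.ent_ext (hw.pull r hr) m l.snd

/-- The projections are jointly monic. -/
lemma prod_hom_ext {f g : W ⟶ prod X Y} (h₁ : f ≫ fst X Y = g ≫ fst X Y)
    (h₂ : f ≫ snd X Y = g ≫ snd X Y) : f = g := by
  obtain ⟨F, rfl⟩ := exists_homMk f
  obtain ⟨G, rfl⟩ := exists_homMk g
  have h₁ := homMk_eq_iff.1 h₁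
  have h₂ := homMk_eq_iff.1 h₂
  refine homMk_eq_iff.2 (FunPred.Equiv.of_ent fun θ w p hw hp h => ?_)
  have k₁ := h₁.ent (x := w) (y := fun i => (p i).1) hw hp.fst
    (FunPred.ent_comp p hp h hp.fst)
  have k₂ := h₂.ent (x := w) (y := fun i => (p i).2) hw hp.snd
    (FunPred.ent_comp p hp h hp.snd)
  refine FunPred.ent_comp_elim k₁ fun θ' r q hr hq hG hqp => ?_
  refine FunPred.ent_comp_elim (k₂.pull r hr) fun θ'' t q' ht hq' hG' hqp' => ?_
  have hw := (hw.pull r hr).pull t ht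
  have e := G.ent_sv hw hq' (hq.pull t ht) hG' (hG.pull t ht)
  exact G.ent_ext hw ((ent_trans e.fst (hqp.pull t ht)).and hqp') hG'

variable (X Y) in
/-- `prod X Y` with its projections is a product. -/
noncomputable def prodIsLimit : IsLimit (BinaryFan.mk (fst X Y) (snd X Y)) :=
  BinaryFan.isLimitMk (fun s => homMk (s.fst.out.pair s.snd.out))
    (fun s => (pair_fst _ _).trans (Quotient.out_eq _))
    (fun s => (pair_snd _ _).trans (Quotient.out_eq _))
    (fun s m h₁ h₂ => prod_hom_ext
      (h₁.trans ((pair_fst _ _).trans (Quotient.out_eq _)).symm)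
      (h₂.trans ((pair_snd _ _).trans (Quotient.out_eq _)).symm))

lemma equalizer_condition (F G : FunPred X Y) :
    equalizerι F G ≫ homMk F = equalizerι F G ≫ homMk G :=
  homMk_eq_iff.2 <| FunPred.Equiv.of_ent fun θ x y hx hy h =>
    FunPred.ent_comp_elim h fun θ' r x' hr hx' hxx' hF => by
      have hxx' : EF.Ent θ' fun j => X.eqv (x (r j)) (x' j) := hxx'
      refine (hx.snd.pull r hr).some_elim fun θ'' t z ht l => ?_
      have hxx' := hxx'.pull t ht
      have hx'' := ent_right hxx'
      have hz := F.ent_ext hxx' l.fst.fst l.fst.snd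
      have e := F.ent_sv hx'' l.fst.fst ((hy.pull r hr).pull t ht) hz (hF.pull t ht)
      exact FunPred.ent_comp (fun j => x' (t j)) hx'' hxx' (G.ent_ext hxx' e l.snd)

/-- The inclusion of the equalizer object is injective: `x ∼ x'` and existence of `x` in the
equalizer already give `x ≈ x'`. -/
lemma equalizer_injective (F G : FunPred X Y) :
    (FunPred.lift (X := equalizer F G) (Y := X) (fun x => x)
      ((evid_two _ _).2 fun _ _ _ h => h.fst)).Injective :=
  fun _ _ _ _ _ hs _ _ l m => (ent_trans l (ent_symm m)).and hs.snd

/-- Every morphism equalizing `[F]` and `[G]` factors through the equalizer object. -/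
lemma exists_equalizer_lift (F G : FunPred X Y) (h : W ⟶ X)
    (w : h ≫ homMk F = h ≫ homMk G) : ∃ l, l ≫ equalizerι F G = h := by
  obtain ⟨H, rfl⟩ := exists_homMk h
  have w := homMk_eq_iff.1 w
  refine ⟨_, H.factor_comp _ (equalizer_injective F G) fun I θ a x ha hx hH => ?_⟩
  have key : EF.Ent θ fun i => (equalizer F G).ex (x i) := by
    refine hx.and (F.ent_tot_elim hx fun θ' r y hr hy hF => ?_)
    have ha := ha.pull r hr
    have hx := hx.pull r hr
    have hH := hH.pull r hr
    refine FunPred.ent_comp_elim (w.ent ha hy (FunPred.ent_comp _ hx hH hF))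
      fun θ'' t x' ht hx' hH' hG => ?_
    have e := H.ent_sv (ha.pull t ht) hx' (hx.pull t ht) hH' (hH.pull t ht)
    exact Ent.some_intro (φ := fun j y =>
        EF.conj (EF.conj (Y.ex y) (F.rel (x (r (t j))) y)) (G.rel (x (r (t j))) y))
      (fun j => y (t j))
      (((hy.pull t ht).and (hF.pull t ht)).and (G.ent_ext e (hy.pull t ht) hG))
  exact FunPred.ent_image x key hx

instance (F G : FunPred X Y) : Mono (equalizerι F G) := (equalizer_injective F G).mono

/-- `equalizer F G` with its inclusion is an equalizer. -/
noncomputable def equalizerIsLimit (F G : FunPred X Y) :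
    IsLimit (Fork.ofι (equalizerι F G) (equalizer_condition F G)) :=
  Fork.IsLimit.mk _ (fun s => (exists_equalizer_lift F G s.ι s.condition).choose)
    (fun s => (exists_equalizer_lift F G s.ι s.condition).choose_spec)
    (fun s m hm => (cancel_mono (equalizerι F G)).1
      (hm.trans (exists_equalizer_lift F G s.ι s.condition).choose_spec.symm))

/-- A functional predicate representing a monomorphism is injective: test the monomorphism on its
kernel pair, the equalizer of the two composites `S × S ⟶ X`. -/
lemma FunPred.injective_of_mono (F : FunPred S X) [Mono (homMk F)] : F.Injective := by
  intro I θ s s' x hs hs' hx h h'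
  let P₁ : FunPred (prod S S) S := lift Prod.fst ((evid_two _ _).2 fun _ _ _ h => h.fst)
  let P₂ : FunPred (prod S S) S := lift Prod.snd ((evid_two _ _).2 fun _ _ _ h => h.snd)
  have e : equalizerι (P₁.comp F) (P₂.comp F) ≫ homMk P₁ =
      equalizerι (P₁.comp F) (P₂.comp F) ≫ homMk P₂ := by
    rw [← cancel_mono (homMk F), Category.assoc, Category.assoc]
    exact equalizer_condition _ _
  have e := homMk_eq_iff.1 e
  have hp : EF.Ent θ fun i => (equalizer (P₁.comp F) (P₂.comp F)).ex (s i, s' i) :=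
    (hs.and hs').and (Ent.some_intro (φ := fun i y => EF.conj (EF.conj (X.ex y)
        ((P₁.comp F).rel (s i, s' i) y)) ((P₂.comp F).rel (s i, s' i) y)) x
      ((hx.and (ent_comp (F := P₁) (x := fun i => (s i, s' i)) s hs hs h)).and
        (ent_comp (F := P₂) (x := fun i => (s i, s' i)) s' hs' hs' h')))
  have k := e.ent (x := fun i => (s i, s' i)) (y := s) hp hs
    (ent_comp (fun i => (s i, s' i)) (hs.and hs') (hs.and hs') hs)
  refine ent_comp_elim k fun θ' r q hr hq hpq hqs => ?_
  have hpq : EF.Ent θ' fun j => (prod S S).eqv (s (r j), s' (r j)) (q j) := hpq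
  exact ent_symm (ent_trans hpq.snd hqs)

end

end EFT

/-! ### Exponentials -/

namespace EFT

open EvidencedFrame

variable {EF : EvidencedFrame.{u, v}}

section

variable {X Y W : EFT EF}

variable (X Y) in
/-- The proposition that `F` is a functional predicate from `X` to `Y`: the conjunction of
extensionality, single-valuedness and totality. Iterated quantifiers are bundled into one
quantifier over a product, to which `ent_all_imp_iff` applies. -/
def isFun (F : X.carrier → Y.carrier → EF.Φ) : EF.Φ :=
  EF.conj (EF.conj
    (EF.all fun p : (X.carrier × X.carrier) × (Y.carrier × Y.carrier) =>
      EF.imp (EF.conj (EF.conj (X.eqv p.1.1 p.1.2) (Y.eqv p.2.1 p.2.2)) (F p.1.1 p.2.1))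
        (F p.1.2 p.2.2))
    (EF.all fun p : X.carrier × (Y.carrier × Y.carrier) =>
      EF.imp (EF.conj (EF.conj (X.ex p.1) (EF.conj (Y.ex p.2.1) (Y.ex p.2.2)))
        (EF.conj (F p.1 p.2.1) (F p.1 p.2.2))) (Y.eqv p.2.1 p.2.2)))
    (EF.all fun x => EF.imp (X.ex x) (EF.some fun y => EF.conj (Y.ex y) (F x y)))

variable (X Y) in
/-- The proposition that `F` and `G` agree on existing elements. -/
def agree (F G : X.carrier → Y.carrier → EF.Φ) : EF.Φ :=
  EF.all fun p : X.carrier × Y.carrier =>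
    EF.imp (EF.conj (X.ex p.1) (Y.ex p.2)) (EF.biimp (F p.1 p.2) (G p.1 p.2))

section

variable {I : Type u} {θ : I → EF.Φ} {F G H : I → X.carrier → Y.carrier → EF.Φ}

lemma ent_isFun_ext (h : EF.Ent θ fun i => isFun X Y (F i)) {x x' : I → X.carrier}
    {y y' : I → Y.carrier} (hx : EF.Ent θ fun i => X.eqv (x i) (x' i))
    (hy : EF.Ent θ fun i => Y.eqv (y i) (y' i)) (hF : EF.Ent θ fun i => F i (x i) (y i)) :
    EF.Ent θ fun i => F i (x' i) (y' i) :=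
  ent_all_imp_iff.1 h.fst.fst θ id (fun i => ((x i, x' i), (y i, y' i))) (Ent.refl θ)
    ((hx.and hy).and hF)

lemma ent_isFun_sv (h : EF.Ent θ fun i => isFun X Y (F i)) {x : I → X.carrier}
    {y y' : I → Y.carrier} (hx : EF.Ent θ fun i => X.ex (x i))
    (hy : EF.Ent θ fun i => Y.ex (y i)) (hy' : EF.Ent θ fun i => Y.ex (y' i))
    (hF : EF.Ent θ fun i => F i (x i) (y i)) (hF' : EF.Ent θ fun i => F i (x i) (y' i)) :
    EF.Ent θ fun i => Y.eqv (y i) (y' i) :=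
  ent_all_imp_iff.1 h.fst.snd θ id (fun i => (x i, (y i, y' i))) (Ent.refl θ)
    ((hx.and (hy.and hy')).and (hF.and hF'))

lemma ent_isFun_tot (h : EF.Ent θ fun i => isFun X Y (F i)) {x : I → X.carrier}
    (hx : EF.Ent θ fun i => X.ex (x i)) :
    EF.Ent θ fun i => EF.some fun y => EF.conj (Y.ex y) (F i (x i) y) :=
  ent_all_imp_iff.1 h.snd θ id x (Ent.refl θ) hx

lemma ent_agree (h : EF.Ent θ fun i => agree X Y (F i) (G i)) {x : I → X.carrier}
    {y : I → Y.carrier} (hx : EF.Ent θ fun i => X.ex (x i))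
    (hy : EF.Ent θ fun i => Y.ex (y i)) :
    EF.Ent θ fun i => EF.biimp (F i (x i) (y i)) (G i (x i) (y i)) :=
  ent_all_imp_iff.1 h θ id (fun i => (x i, y i)) (Ent.refl θ) (hx.and hy)

lemma ent_agree_intro
    (h : ∀ {J : Type u} (θ' : J → EF.Φ) (r : J → I) (x : J → X.carrier) (y : J → Y.carrier),
      EF.Ent θ' (fun j => θ (r j)) → EF.Ent θ' (fun j => X.ex (x j)) →
      EF.Ent θ' (fun j => Y.ex (y j)) → EF.Ent θ' (fun j => F (r j) (x j) (y j)) →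
      EF.Ent θ' fun j => G (r j) (x j) (y j))
    (k : ∀ {J : Type u} (θ' : J → EF.Φ) (r : J → I) (x : J → X.carrier) (y : J → Y.carrier),
      EF.Ent θ' (fun j => θ (r j)) → EF.Ent θ' (fun j => X.ex (x j)) →
      EF.Ent θ' (fun j => Y.ex (y j)) → EF.Ent θ' (fun j => G (r j) (x j) (y j)) →
      EF.Ent θ' fun j => F (r j) (x j) (y j)) :
    EF.Ent θ fun i => agree X Y (F i) (G i) :=
  ent_all_imp_iff.2 fun θ' r p hr hp => Ent.biimp_intro
    (fun θ'' l hF => h θ'' r _ _ (l.trans hr) (l.trans hp.fst) (l.trans hp.snd) hF)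
    (fun θ'' l hG => k θ'' r _ _ (l.trans hr) (l.trans hp.fst) (l.trans hp.snd) hG)

lemma ent_agree_symm (h : EF.Ent θ fun i => agree X Y (F i) (G i)) :
    EF.Ent θ fun i => agree X Y (G i) (F i) :=
  ent_agree_intro (fun θ' r x y hr hx hy hG => (ent_agree (h.pull r hr) hx hy).snd.mp hG)
    (fun θ' r x y hr hx hy hF => (ent_agree (h.pull r hr) hx hy).fst.mp hF)

lemma ent_agree_trans (h : EF.Ent θ fun i => agree X Y (F i) (G i))
    (k : EF.Ent θ fun i => agree X Y (G i) (H i)) :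
    EF.Ent θ fun i => agree X Y (F i) (H i) :=
  ent_agree_intro
    (fun θ' r x y hr hx hy l =>
      (ent_agree (k.pull r hr) hx hy).fst.mp ((ent_agree (h.pull r hr) hx hy).fst.mp l))
    (fun θ' r x y hr hx hy l =>
      (ent_agree (h.pull r hr) hx hy).snd.mp ((ent_agree (k.pull r hr) hx hy).snd.mp l))

end

variable (X Y) in
/-- The exponential object: all `Φ`-valued relations, two of them being equal to the extent that
both are functional predicates and they agree on existing elements. -/
def exp : EFT EF where
  carrier := X.carrier → Y.carrier → EF.Φ
  eqv F G := EF.conj (EF.conj (isFun X Y F) (isFun X Y G)) (agree X Y F G)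
  sym := (evid_two _ _).2 fun _ _ _ h => (h.fst.snd.and h.fst.fst).and (ent_agree_symm h.snd)
  trs := (evid_three _ _).2 fun _ _ _ _ h =>
    (h.fst.fst.fst.and h.snd.fst.snd).and (ent_agree_trans h.fst.snd h.snd.snd)

lemma ent_ex_exp {I : Type u} {θ : I → EF.Φ} {F : I → X.carrier → Y.carrier → EF.Φ}
    (h : EF.Ent θ fun i => isFun X Y (F i)) : EF.Ent θ fun i => (exp X Y).ex (F i) :=
  (h.and h).and (ent_agree_intro (fun _ _ _ _ _ _ _ l => l) (fun _ _ _ _ _ _ _ l => l))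

variable (X Y) in
/-- Evaluation, `((x, F), y) ↦ F(x, y)`. -/
def evalPred : FunPred (prod X (exp X Y)) Y where
  rel p y := p.2 p.1 y
  ext := (evid_four _ _).2 fun θ p q y y' h =>
    ent_isFun_ext h.fst.fst.snd.fst.snd h.fst.fst.fst h.fst.snd
      ((ent_agree h.fst.fst.snd.snd (ent_left h.fst.fst.fst) (ent_left h.fst.snd)).fst.mp h.snd)
  sv := (evid_three _ _).2 fun θ p y y' h =>
    ent_isFun_sv h.fst.fst.fst.fst.snd.fst.fst h.fst.fst.fst.fst.fst h.fst.fst.fst.snd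
      h.fst.fst.snd h.fst.snd h.snd
  tot := (evid_one _ _).2 fun θ p h => ent_isFun_tot h.snd.fst.fst h.fst

/-- The transpose of `H`: it relates `w` to all relations agreeing with `H((-, w), -)`. -/
def curry (H : FunPred (prod X W) Y) : FunPred W (exp X Y) where
  rel w F := agree X Y (fun x y => H.rel (x, w) y) F
  ext := (evid_four _ _).2 fun θ w w' F F' h => by
    refine ent_agree_trans (ent_agree_trans ?_ h.snd) h.fst.snd.snd
    refine ent_agree_intro (fun θ' r x y hr hx hy l => ?_) (fun θ' r x y hr hx hy l => ?_)
    · exact H.ent_ext (x := fun j => (x j, w' (r j))) (x' := fun j => (x j, w (r j)))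
        (hx.and (ent_symm (h.fst.fst.pull r hr))) hy l
    · exact H.ent_ext (x := fun j => (x j, w (r j))) (x' := fun j => (x j, w' (r j)))
        (hx.and (h.fst.fst.pull r hr)) hy l
  sv := (evid_three _ _).2 fun θ w F F' h =>
    (h.fst.fst.fst.snd.fst.fst.and h.fst.fst.snd.fst.fst).and
      (ent_agree_trans (ent_agree_symm h.fst.snd) h.snd)
  tot := (evid_one _ _).2 fun θ w h => by
    -- The witness is `H((-, w), -)` itself, which is functional because `w` exists.
    have k : EF.Ent θ fun i => isFun X Y fun x y => H.rel (x, w i) y := by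
      refine Ent.and (Ent.and ?_ ?_) ?_ <;> refine ent_all_imp_iff.2 fun θ' r p hr hp => ?_
      · exact H.ent_ext (x := fun j => ((p j).1.1, w (r j))) (x' := fun j => ((p j).1.2, w (r j)))
          (hp.fst.fst.and (h.pull r hr)) hp.fst.snd hp.snd
      · exact H.ent_sv (x := fun j => ((p j).1, w (r j)))
          (hp.fst.fst.and (h.pull r hr)) hp.fst.snd.fst hp.fst.snd.snd hp.snd.fst hp.snd.snd
      · exact H.ent_tot (x := fun j => (p j, w (r j))) (hp.and (h.pull r hr))
    exact Ent.some_intro (φ := fun i F => EF.conj ((exp X Y).ex F)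
        (agree X Y (fun x y => H.rel (x, w i) y) F)) (fun i x y => H.rel (x, w i) y)
      ((ent_ex_exp k).and (ent_agree_intro (fun _ _ _ _ _ _ _ l => l)
        (fun _ _ _ _ _ _ _ l => l)))

/-- The functional predicate representing the morphism `X × K` from `X × W` to `X × V`. -/
def FunPred.mapSnd {V : EFT EF} (X : EFT EF) (K : FunPred W V) : FunPred (prod X W) (prod X V) :=
  (FunPred.lift (Y := X) Prod.fst ((evid_two _ _).2 fun _ _ _ h => h.fst)).pair
    ((FunPred.lift (Y := W) Prod.snd ((evid_two _ _).2 fun _ _ _ h => h.snd)).comp K)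

section

variable {I : Type u} {θ : I → EF.Φ} {K : FunPred W (exp X Y)} {x : I → X.carrier}
  {w : I → W.carrier} {y : I → Y.carrier}

/-- Introduction rule for the composite of `X × K` with evaluation: it relates `(x, w)` to `y` when
some existing `F` with `K(w, F)` satisfies `F(x, y)`. -/
lemma ent_uncurry (F : I → X.carrier → Y.carrier → EF.Φ)
    (hx : EF.Ent θ fun i => X.ex (x i)) (hw : EF.Ent θ fun i => W.ex (w i))
    (hF : EF.Ent θ fun i => (exp X Y).ex (F i)) (hK : EF.Ent θ fun i => K.rel (w i) (F i))
    (h : EF.Ent θ fun i => F i (x i) (y i)) :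
    EF.Ent θ fun i => ((K.mapSnd X).comp (evalPred X Y)).rel (x i, w i) (y i) := by
  have hwF : EF.Ent θ fun i => ((FunPred.lift (X := prod X W) (Y := W) Prod.snd
      ((evid_two _ _).2 fun _ _ _ h => h.snd)).comp K).rel (x i, w i) (F i) :=
    FunPred.ent_comp w hw hw hK
  have hm : EF.Ent θ fun i => (K.mapSnd X).rel (x i, w i) (x i, F i) := hx.and hwF
  have hp : EF.Ent θ fun i => (prod X (exp X Y)).ex (x i, F i) := hx.and hF
  have he : EF.Ent θ fun i => (evalPred X Y).rel (x i, F i) (y i) := h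
  exact FunPred.ent_comp _ hp hm he

/-- Elimination rule for the composite of `X × K` with evaluation. -/
lemma ent_uncurry_elim {ψ : I → EF.Φ}
    (hx : EF.Ent θ fun i => X.ex (x i)) (hw : EF.Ent θ fun i => W.ex (w i))
    (hy : EF.Ent θ fun i => Y.ex (y i))
    (h : EF.Ent θ fun i => ((K.mapSnd X).comp (evalPred X Y)).rel (x i, w i) (y i))
    (k : ∀ {J : Type u} (θ' : J → EF.Φ) (r : J → I) (F : J → X.carrier → Y.carrier → EF.Φ),
      EF.Ent θ' (fun j => θ (r j)) → EF.Ent θ' (fun j => (exp X Y).ex (F j)) →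
      EF.Ent θ' (fun j => K.rel (w (r j)) (F j)) →
      EF.Ent θ' (fun j => F j (x (r j)) (y (r j))) → EF.Ent θ' fun j => ψ (r j)) :
    EF.Ent θ ψ := by
  refine FunPred.ent_comp_elim h fun θ' r p hr hp l m => ?_
  have hxp : EF.Ent θ' fun j => X.eqv (x (r j)) (p j).1 := l.fst
  have hwp := l.snd
  refine FunPred.ent_comp_elim hwp fun θ'' s w' hs hw' hww' hK => ?_
  have hww' : EF.Ent θ'' fun j => W.eqv (w (r (s j))) (w' j) := hww'
  have hp := hp.pull s hs
  exact k θ'' (fun j => r (s j)) (fun j => (p (s j)).2) (hr.pull s hs) hp.snd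
    (K.ent_ext (ent_symm hww') hp.snd hK)
    (ent_isFun_ext hp.snd.fst.fst (ent_symm (hxp.pull s hs)) ((hy.pull r hr).pull s hs)
      (m.pull s hs))

end

/-- Existence of the transpose. -/
lemma curry_eval (H : FunPred (prod X W) Y) :
    ((curry H).mapSnd X |>.comp (evalPred X Y)).Equiv H :=
  FunPred.Equiv.of_ent fun θ p y hp hy h =>
    ent_uncurry_elim (x := fun i => (p i).1) (w := fun i => (p i).2) hp.fst hp.snd hy h
      fun θ' r F hr hF hK hFy =>
        (ent_agree (F := fun j x y => H.rel (x, (p (r j)).2) y) hK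
          (hp.fst.pull r hr) (hy.pull r hr)).snd.mp hFy

/-- Uniqueness of the transpose. -/
lemma eq_curry {H : FunPred (prod X W) Y} {K : FunPred W (exp X Y)}
    (h : (K.mapSnd X |>.comp (evalPred X Y)).Equiv H) : K.Equiv (curry H) :=
  FunPred.Equiv.of_ent fun θ w F hw hF hK => by
    change EF.Ent θ fun i => agree X Y (fun x y => H.rel (x, w i) y) (F i)
    refine ent_agree_intro (fun θ' r x y hr hx hy l => ?_) (fun θ' r x y hr hx hy l => ?_)
    · have hw := hw.pull r hr
      refine ent_uncurry_elim hx hw hy (h.symm.ent (x := fun j => (x j, w (r j)))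
        (hx.and hw) hy l) fun θ'' s G hs hG hK' hGy => ?_
      have e := K.ent_sv (hw.pull s hs) hG ((hF.pull r hr).pull s hs) hK' ((hK.pull r hr).pull s hs)
      exact (ent_agree e.snd (hx.pull s hs) (hy.pull s hs)).fst.mp hGy
    · have hw := hw.pull r hr
      exact h.ent (x := fun j => (x j, w (r j))) (hx.and hw) hy
        (ent_uncurry (fun j => F (r j)) hx hw (hF.pull r hr) (hK.pull r hr) l)

variable (EF) in
/-- The cartesian monoidal structure given by the chosen products `prod` and the chosen terminal
object `one`. -/
noncomputable instance cartesianMonoidalCategory : CartesianMonoidalCategory (EFT EF) :=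
  .ofChosenFiniteProducts ⟨_, oneIsTerminal EF⟩ fun X Y => ⟨_, prodIsLimit X Y⟩

open MonoidalCategory

lemma whiskerLeft_homMk {V : EFT EF} (K : FunPred W V) :
    X ◁ homMk K = homMk (K.mapSnd X) :=
  prod_hom_ext ((CartesianMonoidalCategory.whiskerLeft_fst X (homMk K)).trans (pair_fst _ _).symm)
    ((CartesianMonoidalCategory.whiskerLeft_snd X (homMk K)).trans (pair_snd _ _).symm)

variable (X Y W) in
lemma uncurry_bijective :
    Function.Bijective fun k : W ⟶ exp X Y => X ◁ k ≫ homMk (evalPred X Y) := by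
  have key (H : FunPred (prod X W) Y) (K : FunPred W (exp X Y)) :
      X ◁ homMk K ≫ homMk (evalPred X Y) = homMk H ↔ homMk K = homMk (curry H) := by
    refine ⟨fun h => ?_, fun h => ?_⟩
    · rw [whiskerLeft_homMk] at h
      exact homMk_eq_iff.2 (eq_curry (homMk_eq_iff.1 h))
    · rw [h, whiskerLeft_homMk]
      exact homMk_eq_iff.2 (curry_eval H)
  constructor
  · intro k k' h
    obtain ⟨K, rfl⟩ := exists_homMk k
    obtain ⟨K', rfl⟩ := exists_homMk k'
    obtain ⟨H, hH⟩ := exists_homMk (X ◁ homMk K ≫ homMk (evalPred X Y))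
    exact ((key H K).1 hH.symm).trans ((key H K').1 (h.symm.trans hH.symm)).symm
  · intro h
    obtain ⟨H, rfl⟩ := exists_homMk h
    exact ⟨homMk (curry H), (key H _).2 rfl⟩

/-- Transposition of morphisms. -/
noncomputable def curryEquiv (X W Y : EFT EF) :
    ((tensorLeft X).obj W ⟶ Y) ≃ (W ⟶ exp X Y) :=
  (Equiv.ofBijective _ (uncurry_bijective X Y W)).symm

lemma curryEquiv_symm_apply (k : W ⟶ exp X Y) :
    (curryEquiv X W Y).symm k = X ◁ k ≫ homMk (evalPred X Y) := rfl

variable (EF) in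
/-- Cartesian closedness, with `exp X` as the right adjoint of `X × -`. -/
noncomputable instance monoidalClosed : MonoidalClosed (EFT EF) where
  closed X :=
    { rightAdj := _
      adj := Adjunction.adjunctionOfEquivRight (F := tensorLeft X) (curryEquiv X)
        fun W' W Y f g => by
          rw [← Equiv.eq_symm_apply, curryEquiv_symm_apply, MonoidalCategory.whiskerLeft_comp,
            Category.assoc, ← curryEquiv_symm_apply, Equiv.symm_apply_apply]
          rfl }

end

end EFT

/-! ### The subobject classifier -/

namespace EFT

open EvidencedFrame

variable {EF : EvidencedFrame.{u, v}} {S X : EFT EF}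

lemma ent_ex_Omega {I : Type u} (θ φ : I → EF.Φ) : EF.Ent θ fun i => (Omega EF).ex (φ i) :=
  Ent.biimp_intro (fun _ _ h => h) fun _ _ h => h

lemma ent_top_eqv {I : Type u} {θ φ : I → EF.Φ} (h : EF.Ent θ φ) :
    EF.Ent θ fun i => (Omega EF).eqv EF.top (φ i) :=
  Ent.biimp_intro (fun _ l _ => l.trans h) fun θ' _ _ => Ent.top θ'

variable (X) in
/-- The predicate `(x, φ) ↦ ⊤ ↭ φ`, representing the constant morphism `true`. -/
def constTop : FunPred X (Omega EF) :=
  FunPred.lift (fun _ => EF.top) ((evid_two _ _).2 fun θ _ _ _ => ent_top_eqv (Ent.top θ))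

lemma homMk_constTop : homMk (constTop X) = toOne X ≫ true EF :=
  homMk_eq_iff.2 <| FunPred.Equiv.of_ent fun θ x φ hx hφ h =>
    FunPred.ent_comp (x := x) (fun _ => PUnit.unit) (Ent.top θ) (Ent.top θ) h

/-- A morphism to `Omega` classifies the monomorphism `[F]` exactly when the elements it sends to
`⊤` are those in the image of `F`. -/
lemma isPullback_true_iff (F : FunPred S X) [Mono (homMk F)] (C : FunPred X (Omega EF)) :
    IsPullback (homMk F) (toOne S) (homMk C) (true EF) ↔
      ∀ ⦃I : Type u⦄ (θ : I → EF.Φ) (x : I → X.carrier), EF.Ent θ (fun i => X.ex (x i)) →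
        (EF.Ent θ (fun i => C.rel (x i) EF.top) ↔ EF.Ent θ fun i => F.image (x i)) := by
  constructor
  · intro P I θ x hx
    constructor
    · -- The part of `X` sent to `⊤` is the equalizer of `[C]` and the constant morphism `true`.
      intro h
      let ι := equalizerι C (constTop X)
      have w : ι ≫ homMk C = toOne _ ≫ true EF := by
        rw [equalizer_condition, homMk_constTop, ← Category.assoc, eq_toOne (ι ≫ toOne X)]
      obtain ⟨L, hL⟩ := exists_homMk (P.lift ι (toOne _) w)
      have e : homMk L ≫ homMk F = ι := by rw [hL, P.lift_fst]
      have e := (homMk_eq_iff.1 e).symm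
      have hx' : EF.Ent θ fun i => (equalizer C (constTop X)).ex (x i) :=
        hx.and (Ent.some_intro (φ := fun i y => EF.conj
          (EF.conj ((Omega EF).ex y) (C.rel (x i) y)) ((constTop X).rel (x i) y)) (fun _ => EF.top)
          (((ent_ex_Omega θ _).and h).and (ent_ex_Omega θ _)))
      exact FunPred.ent_comp_elim (e.ent hx' hx hx) fun θ' r s hr hs l m =>
        FunPred.ent_image s hs m
    · -- Commutativity makes the value `φ` of `C` at an element of the image equivalent to `⊤`.
      intro h
      have e := P.w
      rw [← homMk_constTop, homMk_comp, homMk_eq_iff] at e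
      refine FunPred.ent_image_elim h fun θ' r s hr hs l => ?_
      have hx := hx.pull r hr
      refine C.ent_tot_elim hx fun θ'' t φ ht hφ hC => ?_
      have hx := hx.pull t ht
      have k := e.ent (hs.pull t ht) hφ
        (FunPred.ent_comp (fun j => x (r (t j))) hx (l.pull t ht) hC)
      exact C.ent_ext hx (ent_symm k) hC
  · intro H
    have w : homMk F ≫ homMk C = toOne S ≫ true EF := by
      rw [← homMk_constTop]
      refine homMk_eq_iff.2 (FunPred.Equiv.of_ent fun θ s φ hs hφ h => ?_)
      refine FunPred.ent_comp_elim h fun θ' r x hr hx l m => ?_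
      exact C.ent_sv hx (ent_ex_Omega _ _) (hφ.pull r hr)
        ((H θ' x hx).2 (FunPred.ent_image _ (hs.pull r hr) l)) m
    -- A morphism sent to `true` by `C` takes its values in the image of `F`, hence factors.
    have key : ∀ {W : EFT EF} (h : W ⟶ X), h ≫ homMk C = toOne W ≫ true EF →
        ∃ l, l ≫ homMk F = h := by
      intro W h e
      obtain ⟨G, rfl⟩ := exists_homMk h
      rw [← homMk_constTop, homMk_comp, homMk_eq_iff] at e
      refine ⟨_, G.factor_comp F F.injective_of_mono fun I θ a x ha hx hG => ?_⟩
      refine (H θ x hx).1 ?_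
      have k := e.symm.ent ha (ent_ex_Omega θ fun _ => EF.top) (ent_ex_Omega θ fun _ => EF.top)
      refine FunPred.ent_comp_elim k fun θ' r x' hr hx' hG' hC => ?_
      exact C.ent_ext (G.ent_sv (ha.pull r hr) hx' (hx.pull r hr) hG' (hG.pull r hr))
        (ent_ex_Omega _ _) hC
    have key' (s : PullbackCone (homMk C) (true EF)) : ∃ l, l ≫ homMk F = s.fst :=
      key s.fst (by rw [s.condition, eq_toOne s.snd])
    exact ⟨⟨w⟩, ⟨PullbackCone.IsLimit.mk w (fun s => (key' s).choose)
      (fun s => (key' s).choose_spec)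
      (fun s => (oneIsTerminal EF).hom_ext _ _)
      (fun s m hm _ => (cancel_mono (homMk F)).1 (hm.trans (key' s).choose_spec.symm))⟩⟩

/-- The characteristic morphism, represented by the function sending `x` to the proposition that
`x` lies in the image. -/
def char (F : FunPred S X) : FunPred X (Omega EF) :=
  FunPred.lift F.image ((evid_two _ _).2 fun _ _ _ h => Ent.biimp_intro
    (fun _ k l => F.ent_image_congr (k.trans h) l)
    (fun _ k l => F.ent_image_congr (ent_symm (k.trans h)) l))

/-- Existence and uniqueness of characteristic morphisms. By `isPullback_true_iff`, a classifying
`C` has `C(x, ⊤)` equivalent to `x` being in the image, and `C(x, φ)` then forces `φ` to be equivalent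
to it: single-valuedness gives one implication, extensionality along `φ ↭ ⊤` the other. -/
lemma existsUnique_char (m : S ⟶ X) [Mono m] :
    ∃! χ : X ⟶ Omega EF, IsPullback m (toOne S) χ (true EF) := by
  obtain ⟨F, rfl⟩ := exists_homMk m
  refine ⟨homMk (char F), ?_, fun χ hχ => ?_⟩
  · exact (isPullback_true_iff F _).2 fun I θ x hx =>
      ⟨fun h => Ent.mp h.snd (Ent.top θ), fun h => ent_symm (ent_top_eqv h)⟩
  · obtain ⟨C, rfl⟩ := exists_homMk χ
    have H := (isPullback_true_iff F C).1 hχ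
    refine homMk_eq_iff.2 (FunPred.Equiv.of_ent fun θ x φ hx hφ h => ?_)
    refine Ent.biimp_intro (fun θ' k l => ?_) fun θ' k l => ?_
    · have e := C.ent_sv (k.trans hx) (ent_ex_Omega θ' fun _ => EF.top) (k.trans hφ)
        ((H θ' x (k.trans hx)).2 l) (k.trans h)
      exact e.fst.mp (Ent.top θ')
    · exact (H θ' x (k.trans hx)).1
        (C.ent_ext (k.trans hx) (ent_symm (ent_top_eqv l)) (k.trans h))

variable (EF) in
/-- `true EF` is a subobject classifier. -/
noncomputable def classifier : Subobject.Classifier (EFT EF) :=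
  .mkOfTerminalΩ₀ (one EF) (oneIsTerminal EF) (Omega EF) (true EF)
    (fun m _ => (existsUnique_char m).choose)
    (fun m _ => (existsUnique_char m).choose_spec.1)
    (fun m _ χ' h => (existsUnique_char m).choose_spec.2 χ' h)

variable (EF) in
lemma hasFiniteLimits : HasFiniteLimits (EFT EF) := by
  have : HasTerminal (EFT EF) := (oneIsTerminal EF).hasTerminal
  have (X Y : EFT EF) : HasLimit (pair X Y) := ⟨⟨_, prodIsLimit X Y⟩⟩
  have : HasBinaryProducts (EFT EF) := hasBinaryProducts_of_hasLimit_pair _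
  have : HasFiniteProducts (EFT EF) := hasFiniteProducts_of_has_binary_and_terminal
  have {X Y : EFT EF} {f g : X ⟶ Y} : HasLimit (parallelPair f g) := by
    obtain ⟨F, rfl⟩ := exists_homMk f
    obtain ⟨G, rfl⟩ := exists_homMk g
    exact ⟨⟨_, equalizerIsLimit F G⟩⟩
  have : HasEqualizers (EFT EF) := hasEqualizers_of_hasLimit_parallelPair _
  exact hasFiniteLimits_of_hasEqualizers_and_finite_products

end EFT

theorem mainTheorem3 (EF : EvidencedFrame.{u, v}) :
    IsElementaryTopos (EFT EF) ∧
    -- the terminal object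
    Nonempty (IsTerminal (EFT.one EF)) ∧
    -- binary products, with the explicit projections and pairings
    (∀ X Y : EFT EF, Nonempty (IsLimit (BinaryFan.mk (EFT.fst X Y) (EFT.snd X Y)))) ∧
    (∀ (W X Y : EFT EF) (F : EFT.FunPred W X) (G : EFT.FunPred W Y),
      EFT.homMk (F.pair G) ≫ EFT.fst X Y = EFT.homMk F ∧
      EFT.homMk (F.pair G) ≫ EFT.snd X Y = EFT.homMk G) ∧
    -- equalizers
    (∀ (X Y : EFT EF) (F G : EFT.FunPred X Y),
      ∃ w : EFT.equalizerι F G ≫ EFT.homMk F = EFT.equalizerι F G ≫ EFT.homMk G,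
        Nonempty (IsLimit (Fork.ofι (EFT.equalizerι F G) w))) ∧
    -- the subobject classifier
    (∀ (S X : EFT EF) (m : S ⟶ X) [Mono m],
      ∃! χ : X ⟶ EFT.Omega EF, IsPullback m (EFT.toOne S) χ (EFT.true EF)) :=
  ⟨⟨EFT.hasFiniteLimits EF, ⟨_, ⟨EFT.monoidalClosed EF⟩⟩, ⟨⟨EFT.classifier EF⟩⟩⟩,
    ⟨EFT.oneIsTerminal EF⟩, fun X Y => ⟨EFT.prodIsLimit X Y⟩,
    fun _ _ _ F G => ⟨EFT.pair_fst F G, EFT.pair_snd F G⟩,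
    fun _ _ F G => ⟨EFT.equalizer_condition F G, ⟨EFT.equalizerIsLimit F G⟩⟩,
    fun _ _ m _ => EFT.existsUnique_char m⟩
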